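/- **Error bound of Algorithm TTF.** Let $G=(V,E)$ be a finite simple connected undirected graph with $n\ge 2$ nodes, $m$ edges and diameter $\Delta$. Write $d(v)$ for the degree of $v$ in $G$ and $\mathrm{vol}(S)=\sum_{v\in S}d(v)$ for $S\subseteq V$. Let $$\kappa=\kappa(G)=\sum_{j\in V}\frac{d(j)}{2m}\,H(i,j)$$ be the Kemeny constant of $G$, where $i\in V$ is any node ($\kappa$ does not depend on it) and $H(i,j)$ is the expected number of steps that the simple random walk started at $i$ needs to visit $j$ for the first time. Fix a root $r\in V$ and a breadth-first search tree $\tau_0$ of $G$ rooted at $r$, that is, a spanning tree in which every node has the same distance from $r$ as in $G$. For a spanning tree $\tau$ of $G$ rooted at $r$, let $\mathrm{Sub}(\tau,v)$ be the node set of the subtree rooted at $v$, and for $v\ne r$ let $p(v)$ be the parent of $v$ in $\tau$. Edges of rooted trees are directed from child to parent. Let $\tau_1,\dots,\tau_\omega$ be independent uniformly random spanning trees of $G$ (the samples drawn by the algorithm). The algorithm TTF starts with an array $\mathrm{volsum}[v]=0$ $(v\in V)$ and calls $\mathrm{DFS}(r,\tau_k,\tau_0)$ for $k=1,\dots,\omega$.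 The call $\mathrm{DFS}(v,\tau,\tau_0)$ does the following. 1. If $v\ne r$ and $(v,p(v))\in\tau_0$, add $2m-\mathrm{vol}(\mathrm{Sub}(\tau,v))$ to $\mathrm{volsum}[u]$ for all $u\in\mathrm{Sub}(\tau_0,v)$. If instead $v\ne r$ and $(p(v),v)\in\tau_0$, subtract $2m-\mathrm{vol}(\mathrm{Sub}(\tau,v))$ from $\mathrm{volsum}[u]$ for all $u\in\mathrm{Sub}(\tau_0,p(v))$. 2. Start the return value at $d(v)\cdot\mathrm{volsum}[v]$, and add to it the values of the recursive calls on the children of $v$ in $\tau$. 3. Undo the update of step 1 and return the value. The output is $$\tilde\kappa=\frac{1}{2m\omega}\sum_{k=1}^{\omega}\mathrm{DFS}(r,\tau_k,\tau_0).$$ Let $\varepsilon>0$ and $p_f>0$. If the sample size satisfies $$\omega\;\ge\;\frac{8m^2\Delta^2\log(2/p_f)}{n^2\varepsilon^2},$$ then $|\tilde\kappa-\kappa|\le\varepsilon\kappa$ with probability at least $1-p_f$. -/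

import Mathlib

open MeasureTheory ProbabilityTheory
open scoped ENNReal

noncomputable section

namespace TTF

/-! ### Random walk and Kemeny constant -/

section Kemeny

variable {V : Type*} [Fintype V] [DecidableEq V] (G : SimpleGraph V) [DecidableRel G.Adj]

/-- The transition matrix `P = D⁻¹ A` of the simple random walk on `G`. -/
def transition (i j : V) : ℝ := G.adjMatrix ℝ i j / (G.degree i : ℝ)

/-- The stationary distribution `π i = d i / (2 m)`. -/
def stationary (i : V) : ℝ := (G.degree i : ℝ) / (2 * (G.edgeFinset.card : ℝ))

/-- `ℙ_i (T_j > k)`, where `T_j` is the first time (time `0` included) at which the walk is at `j`: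
the total probability of the trajectories `x 0, …, x k` that start at `i` and avoid `j`. -/
def avoidProb (i j : V) (k : ℕ) : ℝ :=
  ∑ x : Fin (k + 1) → V with x 0 = i ∧ ∀ s, x s ≠ j,
    ∏ s : Fin k, transition G (x s.castSucc) (x s.succ)

/-- The hitting time `H(i, j) = 𝔼_i [T_j] = ∑_{k ≥ 0} ℙ_i (T_j > k)`, with values in `[0, ∞]`. -/
def hittingTime (i j : V) : ℝ≥0∞ := ∑' k : ℕ, ENNReal.ofReal (avoidProb G i j k)

/-- The Kemeny constant `κ(G) = ∑_j π_j H(i, j)`, computed from the start node `i`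
(its value does not depend on `i` when `G` is connected). -/
def kemeny (i : V) : ℝ := ∑ j, stationary G j * (hittingTime G i j).toReal

end Kemeny

/-! ### Spanning trees, rooted at `r` -/

section Trees

variable {V : Type*}

/-- The set `Γ` of spanning trees of `G`. -/
def SpanningTree (G : SimpleGraph V) : Type _ := {T : SimpleGraph V // T ≤ G ∧ T.IsTree}

instance (G : SimpleGraph V) : MeasurableSpace (SpanningTree G) := ⊤

/-- `T₀` is a breadth-first search tree of `G` with root `r`: a spanning tree in which the distance
of every node from the root is its distance from the root in `G`. -/
def IsBFSTree (G : SimpleGraph V) (r : V) (T₀ : SpanningTree G) : Prop :=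
  ∀ u, T₀.1.dist r u = G.dist r u

/-- In the tree `T` rooted at `r`, the node `p` is the parent of `v`; in other words the edge
`(v, p)`, directed towards the root, belongs to `T`. -/
def IsParent (T : SimpleGraph V) (r p v : V) : Prop :=
  T.Adj v p ∧ T.dist r v = T.dist r p + 1

open scoped Classical in
/-- The parent `p(v)` of `v` in the tree `T` rooted at `r`. The root, which has no parent, is
sent to itself; `(r, r)` is never an edge. -/
def parent (T : SimpleGraph V) (r v : V) : V :=
  if h : ∃ p, IsParent T r p v then h.choose else v

/-- The node set `Sub(T, v)` of the subtree rooted at `v` in the tree `T` rooted at `r`: the nodes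
whose path to `r` in `T` passes through `v`. -/
def subtree (T : SimpleGraph V) (r v : V) : Set V :=
  {u | ∃ p : T.Walk u r, p.IsPath ∧ v ∈ p.support}

end Trees

/-! ### The algorithm -/

section Algorithm

variable {V : Type*} [Fintype V] [DecidableEq V] (G : SimpleGraph V) [DecidableRel G.Adj]

open scoped Classical in
/-- The children of `v` in the tree `T` rooted at `r`, listed in some order. -/
def children (T : SimpleGraph V) (r v : V) : List V :=
  (Finset.univ.filter fun c => IsParent T r v c).toList

open scoped Classical in
/-- The volume `vol(S) = ∑_{u ∈ S} d(u)`, with degrees taken in `G`. -/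
def vol (S : Set V) : ℝ := ∑ u with u ∈ S, (G.degree u : ℝ)

open scoped Classical in
/-- The operation `Add` on the array `volSum`: add `c` to the entries of all nodes of
`Sub(T₀, x)`, which form an interval in the depth-first numbering of `T₀`. -/
def rangeAdd (T₀ : SimpleGraph V) (r x : V) (c : ℝ) (volSum : V → ℝ) : V → ℝ :=
  fun u => if u ∈ subtree T₀ r x then volSum u + c else volSum u

open scoped Classical in
/-- The update of `volSum` on entering `v`. -/
def enter (T T₀ : SimpleGraph V) (r v : V) (volSum : V → ℝ) : V → ℝ :=
  if IsParent T₀ r (parent T r v) v then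
    rangeAdd T₀ r v (2 * (G.edgeFinset.card : ℝ) - vol G (subtree T r v)) volSum
  else if IsParent T₀ r v (parent T r v) then
    rangeAdd T₀ r (parent T r v) (vol G (subtree T r v) - 2 * (G.edgeFinset.card : ℝ)) volSum
  else volSum

open scoped Classical in
/-- The update of `volSum` on leaving `v`, which reverts `enter`. -/
def leave (T T₀ : SimpleGraph V) (r v : V) (volSum : V → ℝ) : V → ℝ :=
  if IsParent T₀ r (parent T r v) v then
    rangeAdd T₀ r v (vol G (subtree T r v) - 2 * (G.edgeFinset.card : ℝ)) volSum
  else if IsParent T₀ r v (parent T r v) then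
    rangeAdd T₀ r (parent T r v) (2 * (G.edgeFinset.card : ℝ) - vol G (subtree T r v)) volSum
  else volSum

/-- The procedure `DFS(v, T, T₀)`. It takes the current array `volSum` and returns the accumulated
value together with the array after the call. The first argument only bounds the depth of the
recursion; started with `n` at the root of a tree on `n` nodes it never runs out. -/
def dfs (T T₀ : SimpleGraph V) (r : V) : ℕ → V → (V → ℝ) → ℝ × (V → ℝ)
  | 0, _, volSum => (0, volSum)
  | fuel + 1, v, volSum =>
    let volSum₁ := enter G T T₀ r v volSum
    let out := (children T r v).foldl
      (fun st c =>
        let res := dfs T T₀ r fuel c st.2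
        (st.1 + res.1, res.2))
      ((G.degree v : ℝ) * volSum₁ v, volSum₁)
    (out.1, leave G T T₀ r v out.2)

/-- The output of the algorithm TTF with root `r` and fixed tree `T₀` on the sampled spanning trees
`τ 0, …, τ (ω - 1)`: `volSum` starts at zero, the values of the calls `DFS(r, τ i, T₀)` are
summed, and the sum is divided by `2 m ω`. -/
def ttf (r : V) (T₀ : SpanningTree G) {ω : ℕ} (τ : Fin ω → SpanningTree G) : ℝ :=
  ((List.ofFn τ).foldl
    (fun st T =>
      let res := dfs G T.1 T₀.1 r (Fintype.card V) r st.2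
      (st.1 + res.1, res.2))
    ((0 : ℝ), fun _ : V => (0 : ℝ))).1 / (2 * (G.edgeFinset.card : ℝ) * (ω : ℝ))

end Algorithm

end TTF

end

/-!
Let `M = 2 m`, and let every edge of the path from `v` to `r` in a sampled tree `T` carry, towards
`r`, a flow equal to the total degree of the nodes that it separates from `v`. When the procedure
reaches `v`, the entry `volSum v` is the total of the net flow through the edges of the path from
`v` to `r` in `T₀`. Deleting an edge of a spanning tree leaves a spanning forest with two
components, so that, summed over all `T`, the net flow through an edge of `G` is a difference of
forest counts, and the total along the path telescopes, whatever `T₀` is. By Kirchhoff's theorem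
these counts are electrical potentials, and these solve the equations of the hitting times: the mean
over `T` of `DFS(r, T, T₀)` is `M κ`.

The nodes of `Sub(T₀, a)`, of volume `x`, receive through the edge above `a` contributions that add
up to at most `y (M - y)` in absolute value, for some `y ≤ x`. These volumes `x` sum to at most
`Δ (M - d r)`, so tangents to the parabola give `|DFS(r, T, T₀)| ≤ M² Δ (n - 1)² / n²`. The
Cauchy-Schwarz inequality for the Laplacian yields `κ ≥ (n - 1)² / n`. Hence a sample, divided by
`M`, is at most `M Δ κ / n` in absolute value, and Hoeffding's inequality concludes.
-/

namespace TTF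

open Finset Matrix
open Relation (ReflTransGen)

section RootedTree

variable {V : Type*} {T : SimpleGraph V} {r : V}

lemma IsParent.adj {p v : V} (h : IsParent T r p v) : T.Adj v p := h.1

lemma IsParent.ne_root {p v : V} (h : IsParent T r p v) : v ≠ r := by
  rintro rfl
  have := h.2
  rw [SimpleGraph.dist_self] at this
  omega

lemma IsParent.asymm {p v : V} (h : IsParent T r p v) : ¬ IsParent T r v p := fun h' => by
  have := h.2
  have := h'.2
  omega

lemma IsParent.exists_isPath (hT : T.IsTree) {p v : V} (h : IsParent T r p v) :
    ∃ q : T.Walk p r, q.IsPath ∧ (SimpleGraph.Walk.cons h.adj q).IsPath := by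
  obtain ⟨q, hq, hl⟩ := hT.connected.exists_path_of_dist p r
  refine ⟨q, hq, SimpleGraph.Walk.isPath_of_length_eq_dist _ ?_⟩
  rw [SimpleGraph.Walk.length_cons, hl, T.dist_comm, T.dist_comm (u := v), h.2]

lemma IsParent.unique (hT : T.IsTree) {p q v : V} (hp : IsParent T r p v)
    (hq : IsParent T r q v) : p = q := by
  obtain ⟨a, -, ha⟩ := hp.exists_isPath hT
  obtain ⟨b, -, hb⟩ := hq.exists_isPath hT
  simpa only [SimpleGraph.Walk.snd_cons] using
    congrArg SimpleGraph.Walk.snd ((hT.existsUnique_path v r).unique ha hb)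

lemma isParent_or_isParent (hT : T.IsTree) {a b : V} (h : T.Adj a b) :
    IsParent T r b a ∨ IsParent T r a b :=
  (hT.dist_eq_dist_add_one_of_adj r h).imp (⟨h, ·⟩) (⟨h.symm, ·⟩)

lemma exists_isParent (hT : T.IsTree) {v : V} (hv : v ≠ r) : ∃ p, IsParent T r p v := by
  obtain ⟨q, -, hl⟩ := hT.connected.exists_path_of_dist v r
  cases q with
  | nil => exact absurd rfl hv
  | @cons _ p _ h q =>
    refine ⟨p, (isParent_or_isParent hT h).resolve_right fun hvp => ?_⟩
    have hpv := hvp.2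
    have hle := SimpleGraph.dist_le q
    rw [SimpleGraph.Walk.length_cons] at hl
    rw [T.dist_comm, T.dist_comm (u := r)] at hpv
    omega

lemma parent_eq (hT : T.IsTree) {p v : V} (h : IsParent T r p v) : parent T r v = p := by
  have hex : ∃ p, IsParent T r p v := ⟨p, h⟩
  rw [parent, dif_pos hex]
  exact hex.choose_spec.unique hT h

lemma parent_root : parent T r r = r :=
  dif_neg fun ⟨_, hp⟩ => hp.ne_root rfl

lemma isParent_parent (hT : T.IsTree) {v : V} (hv : v ≠ r) : IsParent T r (parent T r v) v := by
  obtain ⟨p, hp⟩ := exists_isParent hT hv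
  rwa [parent_eq hT hp]

lemma isParent_iff_ne_root_and_eq_parent (hT : T.IsTree) {p v : V} :
    IsParent T r p v ↔ v ≠ r ∧ p = parent T r v :=
  ⟨fun h => ⟨h.ne_root, (parent_eq hT h).symm⟩, fun ⟨hv, hp⟩ => hp ▸ isParent_parent hT hv⟩

lemma parent_induction (hT : T.IsTree) {P : V → Prop} (root : P r)
    (step : ∀ p v, IsParent T r p v → P p → P v) (v : V) : P v := by
  induction h : T.dist r v generalizing v with
  | zero => exact (hT.connected.dist_eq_zero_iff.1 h) ▸ root
  | succ n ih =>
    obtain ⟨p, hp⟩ := exists_isParent hT (r := r) (v := v) (by rintro rfl; simp at h)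
    exact step p v hp (ih p (by have := hp.2; omega))

lemma mem_subtree_self (hT : T.IsTree) (v : V) : v ∈ subtree T r v :=
  let ⟨q, hq, _⟩ := hT.existsUnique_path v r
  ⟨q, hq, q.start_mem_support⟩

lemma mem_subtree_root (hT : T.IsTree) (v : V) : v ∈ subtree T r r :=
  let ⟨q, hq, _⟩ := hT.existsUnique_path v r
  ⟨q, hq, q.end_mem_support⟩

lemma root_mem_subtree_iff {v : V} : r ∈ subtree T r v ↔ v = r := by
  constructor
  · rintro ⟨q, hq, hv⟩
    rw [SimpleGraph.Walk.nil_iff_support_eq.1 (SimpleGraph.Walk.isPath_iff_nil.1 hq)] at hv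
    exact List.mem_singleton.1 hv
  · rintro rfl
    exact ⟨.nil, .nil, SimpleGraph.Walk.start_mem_support _⟩

lemma IsParent.mem_subtree_iff (hT : T.IsTree) {p u : V} (h : IsParent T r p u) (v : V) :
    u ∈ subtree T r v ↔ u = v ∨ p ∈ subtree T r v := by
  obtain ⟨q, hq, hc⟩ := h.exists_isPath hT
  constructor
  · rintro ⟨w, hw, hv⟩
    rw [(hT.existsUnique_path u r).unique hw hc, SimpleGraph.Walk.support_cons,
      List.mem_cons] at hv
    exact hv.imp Eq.symm (⟨q, hq, ·⟩)
  · rintro (rfl | ⟨w, hw, hv⟩)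
    · exact mem_subtree_self hT _
    · refine ⟨_, hc, ?_⟩
      rw [(hT.existsUnique_path p r).unique hq hw]
      exact List.mem_cons_of_mem _ hv

lemma mem_subtree_iff_reflTransGen (hT : T.IsTree) {u v : V} :
    u ∈ subtree T r v ↔ ReflTransGen (IsParent T r) v u := by
  induction u using parent_induction hT (r := r) with
  | root =>
    rw [root_mem_subtree_iff, ReflTransGen.cases_tail_iff]
    exact ⟨fun h => .inl h.symm, fun h => (h.resolve_right fun ⟨_, _, hp⟩ => hp.ne_root rfl).symm⟩
  | step p u hp ih =>
    rw [hp.mem_subtree_iff hT, ih, ReflTransGen.cases_tail_iff (IsParent T r) v u]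
    exact or_congr_right
      ⟨fun h => ⟨p, h, hp⟩, fun ⟨q, hvq, hq⟩ => hp.unique hT hq ▸ hvq⟩

lemma mem_subtree_iff_exists_child (hT : T.IsTree) {u v : V} :
    u ∈ subtree T r v ↔ u = v ∨ ∃ c, IsParent T r v c ∧ u ∈ subtree T r c := by
  simp only [mem_subtree_iff_reflTransGen hT]
  rw [ReflTransGen.cases_head_iff, eq_comm]

lemma subtree_trans (hT : T.IsTree) {u v w : V} (huv : u ∈ subtree T r v)
    (hvw : v ∈ subtree T r w) : u ∈ subtree T r w := by
  rw [mem_subtree_iff_reflTransGen hT] at *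
  exact hvw.trans huv

lemma subtree_comparable (hT : T.IsTree) {u v w : V} (hv : u ∈ subtree T r v)
    (hw : u ∈ subtree T r w) : v ∈ subtree T r w ∨ w ∈ subtree T r v := by
  have hunique : Relator.RightUnique (Function.swap (IsParent T r)) :=
    fun _ _ _ hp hq => hp.unique hT hq
  rw [mem_subtree_iff_reflTransGen hT, ← Relation.reflTransGen_swap] at hv hw
  simpa only [mem_subtree_iff_reflTransGen hT, Relation.reflTransGen_swap] using
    ReflTransGen.total_of_right_unique hunique hv hw

lemma dist_le_of_mem_subtree (hT : T.IsTree) {u v : V} (h : u ∈ subtree T r v) :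
    T.dist r v ≤ T.dist r u := by
  rw [mem_subtree_iff_reflTransGen hT] at h
  induction h with
  | refl => rfl
  | tail _ hp ih => exact ih.trans (hp.2 ▸ Nat.le_succ _)

lemma IsParent.notMem_subtree (hT : T.IsTree) {p v : V} (h : IsParent T r p v) :
    p ∉ subtree T r v := fun hp => by
  have := dist_le_of_mem_subtree hT hp
  have := h.2
  omega

lemma subtree_antisymm (hT : T.IsTree) {u v : V} (huv : u ∈ subtree T r v)
    (hvu : v ∈ subtree T r u) : u = v := by
  refine ((mem_subtree_iff_exists_child hT).1 huv).resolve_right ?_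
  rintro ⟨c, hc, huc⟩
  exact hc.notMem_subtree hT (subtree_trans hT hvu huc)

lemma child_unique (hT : T.IsTree) {u v c d : V} (hc : IsParent T r v c) (hd : IsParent T r v d)
    (huc : u ∈ subtree T r c) (hud : u ∈ subtree T r d) : c = d := by
  rcases subtree_comparable hT huc hud with h | h
  · exact ((hc.mem_subtree_iff hT d).1 h).resolve_right (hd.notMem_subtree hT)
  · exact (((hd.mem_subtree_iff hT c).1 h).resolve_right (hc.notMem_subtree hT)).symm

lemma IsParent.adj_deleteEdges {p u a b : V} (hp : IsParent T r p u) (h : IsParent T r b a)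
    (hua : u ≠ a) : (T.deleteEdges {s(a, b)}).Adj u p := by
  rw [SimpleGraph.deleteEdges_adj, Set.mem_singleton_iff, Sym2.eq_iff]
  refine ⟨hp.adj, ?_⟩
  rintro (⟨rfl, -⟩ | ⟨rfl, rfl⟩)
  exacts [hua rfl, hp.asymm h]

lemma IsParent.reachable_deleteEdges_of_mem_subtree (hT : T.IsTree) {a b u : V}
    (h : IsParent T r b a) (hu : u ∈ subtree T r a) :
    (T.deleteEdges {s(a, b)}).Reachable u a := by
  rw [mem_subtree_iff_reflTransGen hT] at hu
  induction hu with
  | refl => rfl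
  | tail hap hp ih =>
    refine (hp.adj_deleteEdges h ?_).reachable.trans ih
    rintro rfl
    exact hp.notMem_subtree hT ((mem_subtree_iff_reflTransGen hT).2 hap)

lemma IsParent.reachable_deleteEdges_root (hT : T.IsTree) {a b u : V} (h : IsParent T r b a)
    (hu : u ∉ subtree T r a) : (T.deleteEdges {s(a, b)}).Reachable u r := by
  induction u using parent_induction hT (r := r) with
  | root => rfl
  | step p u hp ih =>
    rw [hp.mem_subtree_iff hT a, not_or] at hu
    exact (hp.adj_deleteEdges h hu.1).reachable.trans (ih hu.2)

lemma IsParent.not_reachable_deleteEdges (hT : T.IsTree) {a b : V} (h : IsParent T r b a) :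
    ¬ (T.deleteEdges {s(a, b)}).Reachable a b :=
  SimpleGraph.isBridge_iff.1
    (SimpleGraph.isAcyclic_iff_forall_adj_isBridge.1 hT.isAcyclic h.adj)

lemma IsParent.reachable_deleteEdges_left_iff (hT : T.IsTree) {a b u : V}
    (h : IsParent T r b a) :
    (T.deleteEdges {s(a, b)}).Reachable u a ↔ u ∈ subtree T r a := by
  refine ⟨fun hua => by_contra fun hu => ?_, h.reachable_deleteEdges_of_mem_subtree hT⟩
  exact h.not_reachable_deleteEdges hT (hua.symm.trans
    ((h.reachable_deleteEdges_root hT hu).trans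
      (h.reachable_deleteEdges_root hT (h.notMem_subtree hT)).symm))

lemma IsParent.reachable_deleteEdges_right_iff (hT : T.IsTree) {a b u : V}
    (h : IsParent T r b a) :
    (T.deleteEdges {s(a, b)}).Reachable u b ↔ u ∉ subtree T r a := by
  refine ⟨fun hub hu => ?_, fun hu => (h.reachable_deleteEdges_root hT hu).trans
    (h.reachable_deleteEdges_root hT (h.notMem_subtree hT)).symm⟩
  exact h.not_reachable_deleteEdges hT
    ((h.reachable_deleteEdges_of_mem_subtree hT hu).symm.trans hub)

end RootedTree

section Path

variable {V : Type*} {T : SimpleGraph V} {r : V}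

/-- The path from `v` to the root `r` in the tree `T` contains the edge `(a, b)`, traversed from
`a` to `b`. -/
def OnPath (T : SimpleGraph V) (r v a b : V) : Prop :=
  IsParent T r b a ∧ v ∈ subtree T r a

/-- The edge `(a, b)` lies on the path from `v` to the root `r` in the tree `T`, but not on the one
from `y`: removing it separates `v` from `y` and `r`. -/
def Separates (T : SimpleGraph V) (r v y a b : V) : Prop :=
  OnPath T r v a b ∧ y ∉ subtree T r a

lemma onPath_def {v a b : V} : OnPath T r v a b ↔ IsParent T r b a ∧ v ∈ subtree T r a := Iff.rfl

lemma not_onPath_root (a b : V) : ¬ OnPath T r r a b :=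
  fun h => h.1.ne_root (root_mem_subtree_iff.1 h.2)

lemma IsParent.onPath_iff (hT : T.IsTree) {p u a b : V} (hp : IsParent T r p u) :
    OnPath T r u a b ↔ a = u ∧ b = p ∨ OnPath T r p a b := by
  constructor
  · rintro ⟨hab, hua⟩
    rcases (hp.mem_subtree_iff hT a).1 hua with rfl | hpa
    · exact .inl ⟨rfl, hab.unique hT hp⟩
    · exact .inr ⟨hab, hpa⟩
  · rintro (⟨rfl, rfl⟩ | ⟨hab, hpa⟩)
    · exact ⟨hp, mem_subtree_self hT _⟩
    · exact ⟨hab, (hp.mem_subtree_iff hT a).2 (.inr hpa)⟩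

lemma separates_root_iff {v a b : V} : Separates T r v r a b ↔ OnPath T r v a b :=
  and_iff_left_of_imp fun h hr => h.1.ne_root (root_mem_subtree_iff.1 hr)

lemma separates_iff_reachable (hT : T.IsTree) {v y a b : V} :
    Separates T r v y a b ↔ T.Adj a b ∧ (T.deleteEdges {s(a, b)}).Reachable v a ∧
      (T.deleteEdges {s(a, b)}).Reachable y b ∧ (T.deleteEdges {s(a, b)}).Reachable r b := by
  constructor
  · rintro ⟨⟨h, hv⟩, hy⟩
    exact ⟨h.adj, (h.reachable_deleteEdges_left_iff hT).2 hv,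
      (h.reachable_deleteEdges_right_iff hT).2 hy,
      (h.reachable_deleteEdges_right_iff hT).2 fun hr => h.ne_root (root_mem_subtree_iff.1 hr)⟩
  · rintro ⟨hab, hv, hy, hr⟩
    rcases isParent_or_isParent (r := r) hT hab with h | h
    · exact ⟨⟨h, (h.reachable_deleteEdges_left_iff hT).1 hv⟩,
        (h.reachable_deleteEdges_right_iff hT).1 hy⟩
    · rw [Sym2.eq_swap] at hr
      exact absurd (root_mem_subtree_iff.1 ((h.reachable_deleteEdges_left_iff hT).1 hr)) h.ne_root

variable [Fintype V]

open scoped Classical in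
lemma IsParent.sum_onPath (hT : T.IsTree) {M : Type*} [AddCommMonoid M] (f : V → V → M) {p u : V}
    (hp : IsParent T r p u) :
    (∑ a, ∑ b, if OnPath T r u a b then f a b else 0) =
      f u p + ∑ a, ∑ b, if OnPath T r p a b then f a b else 0 := by
  have hsplit : ∀ a b, (if OnPath T r u a b then f a b else 0) =
      (if a = u then if b = p then f a b else 0 else 0) +
        if OnPath T r p a b then f a b else 0 := by
    intro a b
    have hdisj : a = u → ¬ OnPath T r p a b := fun hau h => hp.notMem_subtree hT (hau ▸ h.2)
    rw [hp.onPath_iff hT]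
    split_ifs <;> simp_all
  simp only [hsplit, sum_add_distrib]
  rw [sum_eq_single u (fun a _ ha => by simp [ha]) (by simp)]
  simp

open scoped Classical in
lemma sum_onPath_sub (hT : T.IsTree) {A : Type*} [AddCommGroup A] (φ : V → A) (v : V) :
    (∑ a, ∑ b, if OnPath T r v a b then φ a - φ b else 0) = φ v - φ r := by
  induction v using parent_induction hT (r := r) with
  | root => simp [not_onPath_root]
  | step p u hp ih => rw [hp.sum_onPath hT, ih, sub_add_sub_cancel]

open scoped Classical in
lemma sum_onPath_one (hT : T.IsTree) (v : V) :
    (∑ a, ∑ b, if OnPath T r v a b then (1 : ℝ) else 0) = T.dist r v := by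
  induction v using parent_induction hT (r := r) with
  | root => simp [not_onPath_root]
  | step p u hp ih => rw [hp.sum_onPath hT, ih, hp.2, Nat.cast_succ, add_comm]

open scoped Classical in
lemma sum_onPath_netOutflow [DecidableEq V] (hT : T.IsTree) (v w : V) :
    (∑ z, ((if OnPath T r v w z then 1 else 0) - (if OnPath T r v z w then 1 else 0) : ℝ)) =
      (if v = w then 1 else 0) - if r = w then 1 else 0 := by
  rw [← sum_onPath_sub hT (fun u => if u = w then (1 : ℝ) else 0) v]
  have hsplit : ∀ a b, (if OnPath T r v a b then
      (if a = w then 1 else 0) - (if b = w then 1 else 0) else 0 : ℝ) =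
      (if a = w then if OnPath T r v a b then 1 else 0 else 0) -
        if b = w then if OnPath T r v a b then 1 else 0 else 0 := by
    intro a b
    split_ifs <;> simp
  simp only [hsplit, sum_sub_distrib, sum_ite_eq', mem_univ, if_true]
  rw [sum_comm]
  simp

open scoped Classical in
lemma sum_isParent (hT : T.IsTree) {M : Type*} [AddCommMonoid M] (f : V → M) (v : V) :
    (∑ p, if IsParent T r p v then f p else 0) = if v = r then 0 else f (parent T r v) := by
  simp only [isParent_iff_ne_root_and_eq_parent hT]
  split_ifs with hv <;> simp [hv]

end Path

section SubtreeSums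

variable {V : Type*} [Fintype V] {T : SimpleGraph V} {r : V} {M : Type*} [AddCommMonoid M]

open scoped Classical in
lemma sum_subtree (hT : T.IsTree) (f : V → M) (v : V) :
    ∑ u with u ∈ subtree T r v, f u =
      f v + ∑ c with IsParent T r v c, ∑ u with u ∈ subtree T r c, f u := by
  have hunion : ({u | u ∈ subtree T r v} : Finset V) =
      insert v (({c | IsParent T r v c} : Finset V).biUnion fun c => {u | u ∈ subtree T r c}) := by
    ext u
    simpa only [mem_insert, mem_biUnion, mem_filter_univ] using mem_subtree_iff_exists_child hT
  rw [hunion, sum_insert, sum_biUnion]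
  · intro c hc d hd hcd
    rw [mem_coe, mem_filter_univ] at hc hd
    rw [Function.onFun, disjoint_filter]
    exact fun u _ huc hud => hcd (child_unique hT hc hd huc hud)
  · simp only [mem_biUnion, mem_filter_univ, not_exists, not_and]
    exact fun c hc => hc.notMem_subtree hT

open scoped Classical in
lemma sum_between_self (hT : T.IsTree) (f : V → M) (v : V) :
    ∑ w with w ∈ subtree T r v ∧ v ∈ subtree T r w, f w = f v := by
  have hsingleton : ({w | w ∈ subtree T r v ∧ v ∈ subtree T r w} : Finset V) = {v} := by
    ext w
    rw [mem_filter_univ, mem_singleton]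
    refine ⟨fun ⟨hwv, hvw⟩ => subtree_antisymm hT hwv hvw, ?_⟩
    rintro rfl
    exact ⟨mem_subtree_self hT w, mem_subtree_self hT w⟩
  rw [hsingleton, sum_singleton]

open scoped Classical in
lemma IsParent.sum_between (hT : T.IsTree) (f : V → M) {u v c : V} (hc : IsParent T r v c)
    (hu : u ∈ subtree T r c) :
    ∑ w with w ∈ subtree T r v ∧ u ∈ subtree T r w, f w =
      f v + ∑ w with w ∈ subtree T r c ∧ u ∈ subtree T r w, f w := by
  have hcv : c ∈ subtree T r v := (hc.mem_subtree_iff hT v).2 (.inr (mem_subtree_self hT v))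
  have hinsert : ({w | w ∈ subtree T r v ∧ u ∈ subtree T r w} : Finset V) =
      insert v ({w | w ∈ subtree T r c ∧ u ∈ subtree T r w} : Finset V) := by
    ext w
    rw [mem_insert, mem_filter_univ, mem_filter_univ]
    constructor
    · rintro ⟨hwv, huw⟩
      rcases (mem_subtree_iff_exists_child hT).1 hwv with rfl | ⟨d, hd, hwd⟩
      · exact .inl rfl
      · obtain rfl := child_unique hT hc hd hu (subtree_trans hT huw hwd)
        exact .inr ⟨hwd, huw⟩
    · rintro (rfl | ⟨hwc, huw⟩)
      · exact ⟨mem_subtree_self hT _, subtree_trans hT hu hcv⟩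
      · exact ⟨subtree_trans hT hwc hcv, huw⟩
  rw [hinsert, sum_insert fun h => hc.notMem_subtree hT ((mem_filter_univ v).1 h).1]

end SubtreeSums

section AlgorithmValue

lemma foldl_restoring {α S M : Type*} [AddMonoid M] (f : α → S → M × S) (s : S) (l : List α)
    (h : ∀ c ∈ l, (f c s).2 = s) (a : M) :
    l.foldl (fun st c => (st.1 + (f c st.2).1, (f c st.2).2)) (a, s) =
      (a + (l.map fun c => (f c s).1).sum, s) := by
  induction l generalizing a with
  | nil => simp
  | cons c l ih =>
    rw [List.forall_mem_cons] at h
    rw [List.foldl_cons, List.map_cons, List.sum_cons, ← add_assoc, ← ih h.2, h.1]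

variable {V : Type*} [Fintype V] (G : SimpleGraph V) [DecidableRel G.Adj]

open scoped Classical in
/-- The amount that the call of the procedure at `w` adds to the entry `u` of the array. -/
noncomputable def increment (T T₀ : SimpleGraph V) (r w u : V) : ℝ :=
  (if OnPath T₀ r u w (parent T r w) then
    2 * (#G.edgeFinset : ℝ) - vol G (subtree T r w) else 0) -
  if OnPath T₀ r u (parent T r w) w then
    2 * (#G.edgeFinset : ℝ) - vol G (subtree T r w) else 0

lemma enter_eq_add_increment (T T₀ : SimpleGraph V) (r w : V) (s : V → ℝ) :
    enter G T T₀ r w s = s + increment G T T₀ r w := by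
  classical
  funext u
  by_cases hdown : IsParent T₀ r (parent T r w) w
  · have hup := hdown.asymm
    by_cases hu : u ∈ subtree T₀ r w <;> simp [enter, rangeAdd, increment, OnPath, hdown, hup, hu]
  · by_cases hup : IsParent T₀ r w (parent T r w) <;>
    by_cases hu : u ∈ subtree T₀ r (parent T r w) <;>
    simp [enter, rangeAdd, increment, OnPath, hdown, hup, hu]

lemma leave_enter (T T₀ : SimpleGraph V) (r w : V) (s : V → ℝ) :
    leave G T T₀ r w (enter G T T₀ r w s) = s := by
  funext u
  unfold enter leave rangeAdd
  split_ifs <;> simp only <;> split_ifs <;> ring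

open scoped Classical in
/-- The value of the call `DFS(v, T, T₀)` on the array `s`: when the procedure reaches `u`, it has
entered the nodes `w` of the path from `v` to `u` and not left them. -/
noncomputable def dfsValue (T T₀ : SimpleGraph V) (r v : V) (s : V → ℝ) : ℝ :=
  ∑ u with u ∈ subtree T r v, (G.degree u : ℝ) *
    (s u + ∑ w with w ∈ subtree T r v ∧ u ∈ subtree T r w, increment G T T₀ r w u)

variable {T : SimpleGraph V}

open scoped Classical in
lemma dfsValue_eq (hT : T.IsTree) (T₀ : SimpleGraph V) (r v : V) (s : V → ℝ) :
    dfsValue G T T₀ r v s = (G.degree v : ℝ) * enter G T T₀ r v s v +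
      ∑ c with IsParent T r v c, dfsValue G T T₀ r c (enter G T T₀ r v s) := by
  simp only [dfsValue, enter_eq_add_increment, Pi.add_apply]
  rw [sum_subtree hT, sum_between_self hT]
  congr 1
  refine sum_congr rfl fun c hc => sum_congr rfl fun u hu => ?_
  rw [mem_filter_univ] at hc hu
  rw [hc.sum_between hT _ hu, add_assoc]

lemma dist_lt_card (hT : T.IsTree) (u v : V) : T.dist u v < Fintype.card V := by
  obtain ⟨q, hq, hl⟩ := hT.connected.exists_path_of_dist u v
  exact hl ▸ hq.length_lt

lemma dfs_eq (hT : T.IsTree) (T₀ : SimpleGraph V) (r : V) (fuel : ℕ) (v : V) (s : V → ℝ)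
    (h : Fintype.card V ≤ fuel + T.dist r v) :
    dfs G T T₀ r fuel v s = (dfsValue G T T₀ r v s, s) := by
  classical
  induction fuel generalizing v s with
  | zero => exact absurd (dist_lt_card hT r v) (by omega)
  | succ fuel ih =>
    have hchild : ∀ c ∈ children T r v, ∀ s,
        dfs G T T₀ r fuel c s = (dfsValue G T T₀ r c s, s) := by
      intro c hc s
      have hc : IsParent T r v c := by simpa [children] using hc
      have := hc.2
      exact ih c s (by omega)
    simp only [dfs]
    rw [foldl_restoring (fun c st => dfs G T T₀ r fuel c st) (enter G T T₀ r v s) _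
        fun c hc => congrArg Prod.snd (hchild c hc _),
      leave_enter, dfsValue_eq G hT, List.map_congr_left
        fun c hc => congrArg Prod.fst (hchild c hc _), children, sum_map_toList]

open scoped Classical in
/-- Send, for every node `y`, `d y` units of flow from `v` along the path to the root `r` in `T`, up
to the node where it meets the path from `y` to `r`: this is the total flow through `(a, b)`. -/
noncomputable def treeCurrent (T : SimpleGraph V) (r v a b : V) : ℝ :=
  ∑ y with Separates T r v y a b, (G.degree y : ℝ)

lemma sum_degree : ∑ v, (G.degree v : ℝ) = 2 * (#G.edgeFinset : ℝ) := by
  exact_mod_cast G.sum_degrees_eq_twice_card_edges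

open scoped Classical in
lemma vol_add_sum_notMem (S : Set V) :
    vol G S + ∑ y with y ∉ S, (G.degree y : ℝ) = 2 * (#G.edgeFinset : ℝ) := by
  rw [vol, sum_filter_add_sum_filter_not, sum_degree]

open scoped Classical in
lemma treeCurrent_eq (T : SimpleGraph V) (r v a b : V) :
    treeCurrent G T r v a b =
      if OnPath T r v a b then 2 * (#G.edgeFinset : ℝ) - vol G (subtree T r a) else 0 := by
  simp only [treeCurrent, Separates]
  rw [← vol_add_sum_notMem G (subtree T r a), add_sub_cancel_left]
  split_ifs with h <;> simp [h]

open scoped Classical in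
/-- The value of the call `DFS(r, T, T₀)` on the zero array. -/
noncomputable def sampleValue (T T₀ : SimpleGraph V) (r : V) : ℝ :=
  ∑ v, (G.degree v : ℝ) * ∑ a, ∑ b,
    if OnPath T₀ r v a b then treeCurrent G T r v a b - treeCurrent G T r v b a else 0

open scoped Classical in
lemma sum_increment (hT : T.IsTree) (T₀ : SimpleGraph V) (r v : V) :
    ∑ w with v ∈ subtree T r w, increment G T T₀ r w v =
      ∑ a, ∑ b, if OnPath T₀ r v a b then
        treeCurrent G T r v a b - treeCurrent G T r v b a else 0 := by
  have hcollapse : ∀ w, (if v ∈ subtree T r w then increment G T T₀ r w v else 0) =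
      ∑ b, ((if OnPath T₀ r v w b then treeCurrent G T r v w b else 0) -
        if OnPath T₀ r v b w then treeCurrent G T r v w b else 0) := by
    intro w
    have hterm : ∀ b, ((if OnPath T₀ r v w b then treeCurrent G T r v w b else 0) -
        if OnPath T₀ r v b w then treeCurrent G T r v w b else 0) =
        if IsParent T r b w then if v ∈ subtree T r w then
          (if OnPath T₀ r v w b then 2 * (#G.edgeFinset : ℝ) - vol G (subtree T r w) else 0) -
          if OnPath T₀ r v b w then 2 * (#G.edgeFinset : ℝ) - vol G (subtree T r w) else 0
          else 0 else 0 := by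
      intro b
      simp only [treeCurrent_eq, onPath_def (T := T), ite_and]
      split_ifs <;> simp
    simp only [hterm, sum_isParent hT]
    rcases eq_or_ne w r with rfl | hw
    · simp [increment, parent_root, OnPath, IsParent]
    · rw [if_neg hw, increment]
  rw [sum_filter]
  simp only [hcollapse, sum_sub_distrib]
  rw [sum_comm (f := fun w b => if OnPath T₀ r v b w then _ else _)]
  simp only [← sum_sub_distrib, ite_sub_ite, sub_zero]

lemma dfs_root (hT : T.IsTree) (T₀ : SimpleGraph V) (r : V) :
    dfs G T T₀ r (Fintype.card V) r 0 = (sampleValue G T T₀ r, 0) := by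
  classical
  rw [dfs_eq G hT T₀ r _ r 0 (Nat.le_add_right _ _), dfsValue, sampleValue]
  have hbetween : ∀ u, ({w | w ∈ subtree T r r ∧ u ∈ subtree T r w} : Finset V) =
      ({w | u ∈ subtree T r w} : Finset V) :=
    fun u => filter_congr fun w _ => and_iff_right (mem_subtree_root hT w)
  simp only [hbetween, sum_increment G hT, Pi.zero_apply, zero_add]
  simp only [mem_subtree_root hT, filter_true]

lemma ttf_eq (r : V) (T₀ : SpanningTree G) {ω : ℕ} (τ : Fin ω → SpanningTree G) :
    ttf G r T₀ τ =
      (∑ k, sampleValue G (τ k).1 T₀.1 r / (2 * (#G.edgeFinset : ℝ))) / (ω : ℝ) := by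
  have hroot := fun T : SpanningTree G => dfs_root G T.2.2 T₀.1 r
  have hfold := foldl_restoring
    (fun (T : SpanningTree G) s => dfs G T.1 T₀.1 r (Fintype.card V) r s) 0 (List.ofFn τ)
    (fun T _ => congrArg Prod.snd (hroot T)) 0
  simp only [hroot, zero_add, List.map_ofFn, List.sum_ofFn, Function.comp_def] at hfold
  rw [← sum_div, div_div, ttf]
  exact congrArg (fun st => st.1 / _) hfold

end AlgorithmValue

section TwoForest

variable {V : Type*}

/-- `F` is a spanning forest of `G` with exactly two components, one containing `v` and the other
one containing `r`. -/
structure IsTwoForest (G F : SimpleGraph V) (v r : V) : Prop where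
  le : F ≤ G
  isAcyclic : F.IsAcyclic
  not_reachable : ¬ F.Reachable v r
  reachable_or : ∀ w, F.Reachable v w ∨ F.Reachable r w

variable {G F T : SimpleGraph V} {v r y a b : V}

lemma IsTwoForest.not_reachable_left_iff (h : IsTwoForest G F v r) :
    ¬ F.Reachable v y ↔ F.Reachable r y :=
  ⟨(h.reachable_or y).resolve_left, fun hr hv => h.not_reachable (hv.trans hr.symm)⟩

lemma IsTwoForest.not_reachable_of_reachable (h : IsTwoForest G F v r) (ha : F.Reachable v a)
    (hb : F.Reachable r b) : ¬ F.Reachable a b :=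
  fun hab => h.not_reachable (ha.trans (hab.trans hb.symm))

lemma IsTwoForest.swap (h : IsTwoForest G F v r) : IsTwoForest G F r v :=
  ⟨h.le, h.isAcyclic, fun hr => h.not_reachable hr.symm, fun w => (h.reachable_or w).symm⟩

lemma IsTwoForest.congr_right (h : IsTwoForest G F v r) (hy : F.Reachable r y) :
    IsTwoForest G F v y :=
  ⟨h.le, h.isAcyclic, h.not_reachable_left_iff.2 hy,
    fun w => (h.reachable_or w).imp_right hy.symm.trans⟩

lemma deleteEdges_sup_edge (h : ¬ F.Adj a b) :
    (F ⊔ SimpleGraph.edge a b).deleteEdges {s(a, b)} = F := by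
  rw [SimpleGraph.deleteEdges_sup, SimpleGraph.deleteEdges_edge (Set.mem_singleton _), sup_bot_eq,
    SimpleGraph.deleteEdges_eq_self]
  simpa using h

lemma deleteEdges_sup_edge_of_adj (h : T.Adj a b) :
    T.deleteEdges {s(a, b)} ⊔ SimpleGraph.edge a b = T := by
  ext x z
  have hxz : T.Adj x z → x ≠ z := SimpleGraph.Adj.ne
  have hba := h.symm
  simp only [SimpleGraph.sup_adj, SimpleGraph.deleteEdges_adj, SimpleGraph.edge_adj,
    Set.mem_singleton_iff, Sym2.eq_iff]
  constructor
  · rintro (⟨hT, -⟩ | ⟨⟨rfl, rfl⟩ | ⟨rfl, rfl⟩, -⟩) <;> assumption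
  · tauto

lemma IsTwoForest.isTree_sup_edge (h : IsTwoForest G F v r) (ha : F.Reachable v a)
    (hb : F.Reachable r b) : (F ⊔ SimpleGraph.edge a b).IsTree := by
  have hab := h.not_reachable_of_reachable ha hb
  have hne : a ≠ b := fun hab' => hab (hab' ▸ .rfl)
  have hadj : (F ⊔ SimpleGraph.edge a b).Adj a b := by simp [SimpleGraph.edge_adj, hne]
  have hreach : ∀ w, (F ⊔ SimpleGraph.edge a b).Reachable a w := by
    intro w
    rcases h.reachable_or w with hw | hw
    · exact (ha.symm.trans hw).mono le_sup_left
    · exact hadj.reachable.trans ((hb.symm.trans hw).mono le_sup_left)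
  exact ⟨SimpleGraph.connected_iff_exists_forall_reachable _ |>.2 ⟨a, hreach⟩,
    h.isAcyclic.sup_edge_of_not_reachable hab⟩

lemma Separates.isTwoForest (hG : T ≤ G) (hT : T.IsTree) (h : Separates T r v y a b) :
    IsTwoForest G (T.deleteEdges {s(a, b)}) v r := by
  have hba := h.1.1
  obtain ⟨-, hv, -, hr⟩ := (separates_iff_reachable hT).1 h
  refine ⟨(SimpleGraph.deleteEdges_le _).trans hG,
    hT.isAcyclic.anti (SimpleGraph.deleteEdges_le _),
    fun hvr => hba.not_reachable_deleteEdges hT (hv.symm.trans (hvr.trans hr)), fun w => ?_⟩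
  by_cases hw : w ∈ subtree T r a
  · exact .inl (hv.trans ((hba.reachable_deleteEdges_left_iff hT).2 hw).symm)
  · exact .inr (hr.trans ((hba.reachable_deleteEdges_right_iff hT).2 hw).symm)

variable [Fintype V]

open scoped Classical in
/-- The spanning trees of `G`. -/
noncomputable def trees (G : SimpleGraph V) : Finset (SimpleGraph V) := {T | T ≤ G ∧ T.IsTree}

lemma mem_trees : T ∈ trees G ↔ T ≤ G ∧ T.IsTree := by
  classical
  exact mem_filter_univ T

lemma card_trees_pos (hG : G.Connected) : 0 < #(trees G) :=
  let ⟨T, hT⟩ := hG.exists_isTree_le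
  card_pos.2 ⟨T, mem_trees.2 hT⟩

open scoped Classical in
/-- The number of spanning forests of `G` with two components, one containing `v` and `a`, the
other one containing `r` and `y`. -/
noncomputable def forestCount (G : SimpleGraph V) (v a r y : V) : ℕ :=
  #{F : SimpleGraph V | IsTwoForest G F v r ∧ F.Reachable v a ∧ F.Reachable r y}

lemma forestCount_right : forestCount G v r r y = 0 := by
  classical
  rw [forestCount, card_eq_zero, filter_eq_empty_iff]
  exact fun F _ h => h.1.not_reachable h.2.1

lemma forestCount_self_comm (v r y : V) : forestCount G v v r y = forestCount G y r v v := by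
  classical
  refine congrArg card (filter_congr fun F _ => ?_)
  constructor
  · rintro ⟨h, -, hy⟩
    exact ⟨(h.congr_right hy).swap, hy.symm, .rfl⟩
  · rintro ⟨h, hr, -⟩
    exact ⟨h.swap.congr_right hr, .rfl, hr.symm⟩

open scoped Classical in
/-- Deleting the edge `(a, b)` from a tree in which it separates `v` from `y` and `r` leaves a
forest with two components, and this is reversible. -/
lemma card_separates (hab : G.Adj a b) :
    #{T ∈ trees G | Separates T r v y a b} =
      #{F : SimpleGraph V | (IsTwoForest G F v r ∧ F.Reachable v a ∧ F.Reachable r y) ∧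
        ¬ F.Reachable v b} := by
  refine card_nbij' (fun T => T.deleteEdges {s(a, b)}) (fun F => F ⊔ SimpleGraph.edge a b)
    (fun T hT => ?_) (fun F hF => ?_) (fun T hT => ?_) (fun F hF => ?_)
  · obtain ⟨hT, hsep⟩ := mem_filter.1 hT
    obtain ⟨hle, hT⟩ := mem_trees.1 hT
    have hF := hsep.isTwoForest hle hT
    obtain ⟨-, hv, hy, hr⟩ := (separates_iff_reachable hT).1 hsep
    exact (mem_filter_univ _).2
      ⟨⟨hF, hv, hr.trans hy.symm⟩, hF.not_reachable_left_iff.2 hr⟩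
  · obtain ⟨⟨hF, ha, hy⟩, hb⟩ := (mem_filter_univ _).1 hF
    rw [hF.not_reachable_left_iff] at hb
    have hle : F ⊔ SimpleGraph.edge a b ≤ G :=
      sup_le hF.le ((SimpleGraph.edge_le_iff _).2 (.inr hab))
    have hT := hF.isTree_sup_edge ha hb
    have hnadj : ¬ F.Adj a b := fun h => hF.not_reachable_of_reachable ha hb h.reachable
    refine mem_filter.2 ⟨mem_trees.2 ⟨hle, hT⟩, (separates_iff_reachable hT).2 ?_⟩
    rw [deleteEdges_sup_edge hnadj]
    exact ⟨by simp [SimpleGraph.edge_adj, hab.ne], ha, hy.symm.trans hb, hb⟩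
  · exact deleteEdges_sup_edge_of_adj (mem_filter.1 hT).2.1.1.adj
  · obtain ⟨⟨hF, ha, -⟩, hb⟩ := (mem_filter_univ _).1 hF
    rw [hF.not_reachable_left_iff] at hb
    exact deleteEdges_sup_edge fun h => hF.not_reachable_of_reachable ha hb h.reachable

open scoped Classical in
lemma sum_separates (hab : G.Adj a b) :
    ∑ T ∈ trees G, ((if Separates T r v y a b then 1 else 0) -
      (if Separates T r v y b a then 1 else 0) : ℝ) =
        forestCount G v a r y - forestCount G v b r y := by
  have hsplit : ∀ a b, forestCount G v a r y =
      #{F : SimpleGraph V | (IsTwoForest G F v r ∧ F.Reachable v a ∧ F.Reachable r y) ∧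
        F.Reachable v b} +
      #{F : SimpleGraph V | (IsTwoForest G F v r ∧ F.Reachable v a ∧ F.Reachable r y) ∧
        ¬ F.Reachable v b} := by
    intro a b
    rw [forestCount, ← card_filter_add_card_filter_not fun F => F.Reachable v b, filter_filter,
      filter_filter]
  have hsymm : ∀ F : SimpleGraph V,
      ((IsTwoForest G F v r ∧ F.Reachable v b ∧ F.Reachable r y) ∧ F.Reachable v a) ↔
        (IsTwoForest G F v r ∧ F.Reachable v a ∧ F.Reachable r y) ∧ F.Reachable v b := by
    tauto
  rw [sum_sub_distrib, sum_boole, sum_boole, card_separates hab, card_separates hab.symm,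
    hsplit a b, hsplit b a]
  simp only [hsymm]
  push_cast
  ring

end TwoForest

section Potential

variable {V : Type*} [Fintype V] {G : SimpleGraph V} [DecidableRel G.Adj]

/-- The potential at `w`, relative to the ground node `r`, of the network of unit resistors on the
edges of `G` into each node `v` of which a current of `d v` units is injected, which is taken out
at `r`. By Kirchhoff's theorem a unit current injected at `v` creates the potential
`forestCount G v w r r / #(trees G)`. -/
noncomputable def potential (G : SimpleGraph V) [DecidableRel G.Adj] (r w : V) : ℝ :=
  (∑ v, (G.degree v : ℝ) * forestCount G v w r r) / #(trees G)

lemma potential_nonneg (r w : V) : 0 ≤ potential G r w := by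
  unfold potential
  positivity

lemma potential_self (r : V) : potential G r r = 0 := by
  simp [potential, forestCount_right]

lemma sum_treeCurrent_sub {a b : V} (hab : G.Adj a b) (r v : V) :
    ∑ T ∈ trees G, (treeCurrent G T r v a b - treeCurrent G T r v b a) =
      ∑ y, (G.degree y : ℝ) * forestCount G v a r y -
        ∑ y, (G.degree y : ℝ) * forestCount G v b r y := by
  classical
  simp only [← sum_sub_distrib, ← mul_sub, ← sum_separates hab, mul_sum]
  rw [sum_comm]
  refine sum_congr rfl fun T _ => ?_
  simp only [treeCurrent, sum_filter, ← sum_sub_distrib, mul_sub, mul_ite, mul_one, mul_zero]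

lemma sum_sampleValue (hG : G.Connected) {T₀ : SimpleGraph V} (hle : T₀ ≤ G) (hT₀ : T₀.IsTree)
    (r : V) :
    ∑ T ∈ trees G, sampleValue G T T₀ r =
      #(trees G) * ∑ v, (G.degree v : ℝ) * potential G v r := by
  classical
  have hpath : ∀ v, (∑ T ∈ trees G, ∑ a, ∑ b, if OnPath T₀ r v a b then
      treeCurrent G T r v a b - treeCurrent G T r v b a else 0) =
      #(trees G) * potential G v r := by
    intro v
    calc _ = ∑ a, ∑ b, if OnPath T₀ r v a b then
          ∑ y, (G.degree y : ℝ) * forestCount G v a r y -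
            ∑ y, (G.degree y : ℝ) * forestCount G v b r y else 0 := by
          rw [sum_comm]
          refine sum_congr rfl fun a _ => ?_
          rw [sum_comm]
          refine sum_congr rfl fun b _ => ?_
          split_ifs with h
          · exact sum_treeCurrent_sub (hle h.1.adj) r v
          · exact sum_const_zero
      _ = ∑ y, (G.degree y : ℝ) * forestCount G v v r y := by
          rw [sum_onPath_sub hT₀ (fun a => ∑ y, (G.degree y : ℝ) * forestCount G v a r y)]
          simp [forestCount_right]
      _ = #(trees G) * potential G v r := by
          have := card_trees_pos hG
          rw [potential, mul_div_cancel₀ _ (by positivity)]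
          simp only [forestCount_self_comm v r]
  simp only [sampleValue]
  rw [sum_comm, mul_sum]
  refine sum_congr rfl fun v _ => ?_
  rw [← mul_sum, hpath, mul_left_comm]

lemma lapMatrix_mulVec_eq_sum_adj [DecidableEq V] (f : V → ℝ) (w : V) :
    (G.lapMatrix ℝ *ᵥ f) w = ∑ z, if G.Adj w z then f w - f z else 0 := by
  rw [SimpleGraph.lapMatrix_mulVec_apply, SimpleGraph.degree_eq_sum_if_adj, sum_mul,
    SimpleGraph.neighborFinset_eq_filter, sum_filter, ← sum_sub_distrib]
  refine sum_congr rfl fun z _ => ?_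
  split_ifs <;> simp

lemma lapMatrix_mulVec_forestCount [DecidableEq V] (v r : V) :
    G.lapMatrix ℝ *ᵥ (fun w => (forestCount G v w r r : ℝ)) =
      (#(trees G) : ℝ) • (Pi.single v 1 - Pi.single r 1) := by
  classical
  ext w
  have hadj : ∀ z, (if G.Adj w z then
      (forestCount G v w r r - forestCount G v z r r : ℝ) else 0) =
      ∑ T ∈ trees G, ((if OnPath T r v w z then 1 else 0) - if OnPath T r v z w then 1 else 0) := by
    intro z
    split_ifs with h
    · simp only [← sum_separates h, separates_root_iff]
    · refine (sum_eq_zero fun T hT => ?_).symm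
      have hwz : ¬ T.Adj w z := fun hT' => h ((mem_trees.1 hT).1 hT')
      rw [if_neg fun hp => hwz hp.1.adj, if_neg fun hp => hwz hp.1.adj.symm, sub_zero]
  rw [lapMatrix_mulVec_eq_sum_adj, sum_congr rfl fun z _ => hadj z, sum_comm,
    sum_congr rfl fun T hT => sum_onPath_netOutflow (mem_trees.1 hT).2 v w, sum_const]
  simp [Pi.single_apply, eq_comm]

lemma lapMatrix_mulVec_potential [DecidableEq V] (hG : G.Connected) (r : V) :
    G.lapMatrix ℝ *ᵥ potential G r =
      (fun w => (G.degree w : ℝ)) - Pi.single r (2 * (#G.edgeFinset : ℝ)) := by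
  have hN : (#(trees G) : ℝ) ≠ 0 := by
    have := card_trees_pos hG
    positivity
  have hpot : potential G r = (#(trees G) : ℝ)⁻¹ •
      ∑ v, (G.degree v : ℝ) • fun w => (forestCount G v w r r : ℝ) := by
    ext w
    simp [potential, div_eq_inv_mul]
  have hsum : ∑ v, (G.degree v : ℝ) • (Pi.single v 1 - Pi.single r 1 : V → ℝ) =
      (fun w => (G.degree w : ℝ)) - Pi.single r (2 * (#G.edgeFinset : ℝ)) := by
    ext w
    simp [Pi.single_apply, mul_sub, ← sum_degree G]
  rw [hpot, mulVec_smul, mulVec_sum]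
  simp only [mulVec_smul, lapMatrix_mulVec_forestCount, smul_comm _ (#(trees G) : ℝ), ← smul_sum]
  rw [smul_smul, mul_inv_cancel₀ hN, one_smul, hsum]

/-- Cauchy-Schwarz for the energy form of the Laplacian, applied to the potential and the indicator
function of the ground node. -/
lemma sq_sub_degree_le (hG : G.Connected) (j : V) :
    (2 * (#G.edgeFinset : ℝ) - G.degree j) ^ 2 ≤
      G.degree j * ∑ i, (G.degree i : ℝ) * potential G j i := by
  classical
  have hpos : ∀ f, 0 ≤ (G.lapMatrix ℝ).toBilin' f f := by
    intro f
    rw [toBilin'_apply']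
    exact (SimpleGraph.posSemidef_lapMatrix ℝ G).dotProduct_mulVec_nonneg f
  have hsymm : (G.lapMatrix ℝ).toBilin'.IsSymm :=
    isSymm_toBilin'_iff_isSymm.2 (G.isSymm_lapMatrix ℝ)
  have hCS := (G.lapMatrix ℝ).toBilin'.apply_sq_le_of_symm hpos ⟨hsymm.eq⟩ (Pi.single j 1)
    (potential G j)
  have hdiag : (G.lapMatrix ℝ).toBilin' (Pi.single j 1) (Pi.single j 1) = G.degree j := by
    simp [SimpleGraph.lapMatrix, SimpleGraph.degMatrix]
  simp only [hdiag, toBilin'_apply', lapMatrix_mulVec_potential hG] at hCS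
  simp only [dotProduct_sub, single_dotProduct, dotProduct_single, potential_self, one_mul,
    zero_mul, sub_zero, Pi.single_eq_same] at hCS
  rw [sub_sq_comm, ← dotProduct, dotProduct_comm]
  exact hCS

end Potential

section HittingTime

variable {V : Type*} [Fintype V] {G : SimpleGraph V} [DecidableRel G.Adj]

lemma transition_nonneg (i j : V) : 0 ≤ transition G i j := by
  rw [transition, SimpleGraph.adjMatrix_apply]
  positivity

lemma sum_transition_mul [DecidableEq V] {i : V} (hi : G.degree i ≠ 0) (f : V → ℝ) :
    ∑ l, transition G i l * f l = f i - (G.lapMatrix ℝ *ᵥ f) i / G.degree i := by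
  rw [SimpleGraph.lapMatrix_mulVec_apply, sub_div, mul_div_cancel_left₀ _ (Nat.cast_ne_zero.2 hi),
    sub_sub_cancel, SimpleGraph.neighborFinset_eq_filter, sum_filter, sum_div]
  refine sum_congr rfl fun l _ => ?_
  rw [transition, SimpleGraph.adjMatrix_apply]
  split_ifs <;> simp [div_eq_inv_mul]

/-- The equation that determines the hitting times. -/
lemma potential_eq_one_add_sum [Nontrivial V] (hG : G.Connected) {i j : V} (hij : i ≠ j) :
    potential G j i = 1 + ∑ l, transition G i l * potential G j l := by
  classical
  have hd := (hG.preconnected.degree_pos_of_nontrivial i).ne'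
  rw [sum_transition_mul hd, lapMatrix_mulVec_potential hG, Pi.sub_apply,
    Pi.single_eq_of_ne hij, sub_zero, div_self (Nat.cast_ne_zero.2 hd), add_sub_cancel]

variable [DecidableEq V]

lemma avoidProb_nonneg (i j : V) (k : ℕ) : 0 ≤ avoidProb G i j k :=
  sum_nonneg fun _ _ => prod_nonneg fun _ _ => transition_nonneg _ _

lemma avoidProb_zero {i j : V} (hij : i ≠ j) : avoidProb G i j 0 = 1 := by
  have hsingleton : ({x | x 0 = i ∧ ∀ s, x s ≠ j} : Finset (Fin 1 → V)) = {fun _ => i} := by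
    ext x
    simp only [mem_filter_univ, mem_singleton, funext_iff, Fin.forall_fin_one]
    exact and_iff_left_of_imp fun hx => hx ▸ hij
  rw [avoidProb, hsingleton, sum_singleton, Fin.prod_univ_zero]

lemma avoidProb_self (j : V) (k : ℕ) : avoidProb G j j k = 0 := by
  rw [avoidProb, filter_false_of_mem fun x _ h => h.2 0 h.1, sum_empty]

lemma sum_trajectories_succ {M : Type*} [AddCommMonoid M] {i j : V} (hij : i ≠ j) {k : ℕ}
    (f : (Fin (k + 2) → V) → M) :
    ∑ x : Fin (k + 2) → V with x 0 = i ∧ ∀ s, x s ≠ j, f x =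
      ∑ x : Fin (k + 1) → V with ∀ s, x s ≠ j, f (Fin.cons i x) := by
  refine sum_nbij' Fin.tail (fun x => Fin.cons i x) (fun x hx => ?_) (fun x hx => ?_)
    (fun x hx => ?_) (fun x _ => Fin.tail_cons (α := fun _ => V) i x) (fun x hx => ?_)
  · exact (mem_filter_univ _).2 fun s => ((mem_filter_univ x).1 hx).2 s.succ
  · exact (mem_filter_univ _).2 ⟨rfl, Fin.cases hij ((mem_filter_univ x).1 hx)⟩
  all_goals
    obtain ⟨rfl, -⟩ := (mem_filter_univ x).1 hx
    rw [Fin.cons_self_tail]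

lemma avoidProb_succ {i j : V} (hij : i ≠ j) (k : ℕ) :
    avoidProb G i j (k + 1) = ∑ l, transition G i l * avoidProb G l j k := by
  have hcons : ∀ x : Fin (k + 1) → V,
      ∏ s : Fin (k + 1), transition G ((Fin.cons i x : Fin (k + 2) → V) s.castSucc)
        ((Fin.cons i x : Fin (k + 2) → V) s.succ) =
      transition G i (x 0) * ∏ s : Fin k, transition G (x s.castSucc) (x s.succ) := by
    intro x
    simp only [Fin.prod_univ_succ (n := k), Fin.castSucc_zero, ← Fin.succ_castSucc, Fin.cons_zero,
      Fin.cons_succ]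
  rw [avoidProb, sum_trajectories_succ hij, sum_congr rfl fun x _ => hcons x,
    ← sum_fiberwise _ fun x => x 0]
  refine sum_congr rfl fun l _ => ?_
  rw [avoidProb, mul_sum, filter_filter]
  simp only [and_comm (b := _ = l)]
  refine sum_congr rfl fun x hx => ?_
  rw [((mem_filter_univ x).1 hx).1]

lemma potential_sub_sum_avoidProb_mem [Nontrivial V] (hG : G.Connected) {C : ℝ} {j : V}
    (hC : ∀ i, potential G j i ≤ C) (N : ℕ) (i : V) :
    potential G j i - ∑ k ∈ range N, avoidProb G i j k ∈ Set.Icc 0 (C * avoidProb G i j N) := by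
  rcases eq_or_ne i j with rfl | hij
  · simp [potential_self, avoidProb_self]
  induction N generalizing i with
  | zero => simp [potential_nonneg, hC, avoidProb_zero hij]
  | succ N ih =>
    have ih : ∀ l, potential G j l - ∑ k ∈ range N, avoidProb G l j k ∈
        Set.Icc 0 (C * avoidProb G l j N) := by
      intro l
      rcases eq_or_ne l j with rfl | hl
      · simp [potential_self, avoidProb_self]
      · exact ih l hl
    have hstep : potential G j i - ∑ k ∈ range (N + 1), avoidProb G i j k =
        ∑ l, transition G i l * (potential G j l - ∑ k ∈ range N, avoidProb G l j k) := by
      rw [sum_range_succ', avoidProb_zero hij, potential_eq_one_add_sum hG hij]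
      simp only [avoidProb_succ hij, mul_sub, sum_sub_distrib, mul_sum]
      rw [sum_comm]
      ring
    rw [hstep, avoidProb_succ hij, mul_sum]
    refine ⟨sum_nonneg fun l _ => mul_nonneg (transition_nonneg _ _) (ih l).1,
      sum_le_sum fun l _ => ?_⟩
    rw [mul_left_comm]
    exact mul_le_mul_of_nonneg_left (ih l).2 (transition_nonneg _ _)

lemma hasSum_avoidProb [Nontrivial V] (hG : G.Connected) (i j : V) :
    HasSum (avoidProb G i j) (potential G j i) := by
  have hC : ∀ i, potential G j i ≤ ∑ i, potential G j i := fun i =>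
    single_le_sum (fun i _ => potential_nonneg j i) (mem_univ i)
  have hmem := fun N => potential_sub_sum_avoidProb_mem hG hC N i
  have hsummable : Summable (avoidProb G i j) :=
    summable_of_sum_range_le (avoidProb_nonneg i j) fun N => sub_nonneg.1 (hmem N).1
  have htail := squeeze_zero (fun N => (hmem N).1) (fun N => (hmem N).2)
    (by simpa using hsummable.tendsto_atTop_zero.const_mul (∑ i, potential G j i))
  rw [hasSum_iff_tendsto_nat_of_nonneg (avoidProb_nonneg i j)]
  simpa using htail.const_sub (potential G j i)

lemma toReal_hittingTime [Nontrivial V] (hG : G.Connected) (i j : V) :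
    (hittingTime G i j).toReal = potential G j i := by
  have h := hasSum_avoidProb hG i j
  rw [hittingTime, ← ENNReal.ofReal_tsum_of_nonneg (avoidProb_nonneg i j) h.summable,
    h.tsum_eq, ENNReal.toReal_ofReal (potential_nonneg j i)]

end HittingTime

section Kemeny

variable {V : Type*} [Fintype V] [Nontrivial V] {G : SimpleGraph V} [DecidableRel G.Adj]

lemma two_mul_card_edgeFinset_pos (hG : G.Connected) : 0 < 2 * (#G.edgeFinset : ℝ) := by
  rw [← sum_degree]
  exact sum_pos (fun v _ => Nat.cast_pos.2 (hG.preconnected.degree_pos_of_nontrivial v))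
    univ_nonempty

variable [DecidableEq V]

lemma kemeny_eq (hG : G.Connected) (i : V) :
    kemeny G i = (∑ j, (G.degree j : ℝ) * potential G j i) / (2 * (#G.edgeFinset : ℝ)) := by
  simp only [kemeny, stationary, toReal_hittingTime hG, sum_div, div_mul_eq_mul_div]

lemma kemeny_const (hG : G.Connected) (i j : V) : kemeny G i = kemeny G j := by
  have hharmonic :
      G.lapMatrix ℝ *ᵥ (∑ v, (G.degree v : ℝ) • potential G v) = 0 := by
    simp only [mulVec_sum, mulVec_smul, lapMatrix_mulVec_potential hG]
    ext w
    simp [mul_sub, Pi.single_apply, ← sum_mul, sum_degree, mul_comm (G.degree w : ℝ)]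
  have hconst := G.lapMatrix_mulVec_eq_zero_iff_forall_reachable.1 hharmonic i j (hG i j)
  simp only [Finset.sum_apply, Pi.smul_apply, smul_eq_mul] at hconst
  rw [kemeny_eq hG, kemeny_eq hG, hconst]

lemma le_kemeny (hG : G.Connected) (i : V) :
    ((Fintype.card V : ℝ) - 1) ^ 2 / Fintype.card V ≤ kemeny G i := by
  have hM := two_mul_card_edgeFinset_pos hG
  set M := 2 * (#G.edgeFinset : ℝ) with hM_def
  have hkemeny : ∑ j, (G.degree j : ℝ) * ∑ w, (G.degree w : ℝ) * potential G j w =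
      M ^ 2 * kemeny G i := by
    calc _ = ∑ w, (G.degree w : ℝ) * (M * kemeny G w) := by
          simp only [kemeny_eq hG, ← hM_def, mul_div_cancel₀ _ hM.ne', mul_sum]
          rw [sum_comm]
          simp only [mul_left_comm]
      _ = _ := by
          simp only [kemeny_const hG _ i]
          rw [← sum_mul, sum_degree, ← mul_assoc, sq]
  have hdegree : ∑ j : V, (M - G.degree j) = M * (Fintype.card V - 1) := by
    rw [sum_sub_distrib, sum_degree, sum_const, card_univ, nsmul_eq_mul, mul_sub_one, mul_comm]
  rw [div_le_iff₀ (by positivity)]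
  refine le_of_mul_le_mul_left ?_ (pow_pos hM 2)
  calc M ^ 2 * ((Fintype.card V : ℝ) - 1) ^ 2 = (∑ j : V, (M - G.degree j)) ^ 2 := by
        rw [hdegree]
        ring
    _ ≤ Fintype.card V * ∑ j, (M - G.degree j) ^ 2 := sq_sum_le_card_mul_sum_sq
    _ ≤ Fintype.card V * (M ^ 2 * kemeny G i) := by
        rw [← hkemeny]
        gcongr
        exact sq_sub_degree_le hG _
    _ = M ^ 2 * (kemeny G i * Fintype.card V) := by ring

lemma kemeny_pos (hG : G.Connected) (i : V) : 0 < kemeny G i := by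
  have : 0 < (Fintype.card V : ℝ) - 1 := sub_pos.2 (Nat.one_lt_cast.2 Fintype.one_lt_card)
  exact (by positivity : 0 < ((Fintype.card V : ℝ) - 1) ^ 2 / Fintype.card V).trans_le
    (le_kemeny hG i)

end Kemeny

lemma diam_pos {V : Type*} [Finite V] [Nontrivial V] {G : SimpleGraph V} (hG : G.Connected) :
    0 < G.diam := by
  obtain ⟨a, b, hab⟩ := exists_pair_ne V
  exact (hG.pos_dist_of_ne hab).trans_le
    (SimpleGraph.dist_le_diam (G.connected_iff_ediam_ne_top.1 hG))

section Range

variable {V : Type*} [Fintype V] {G : SimpleGraph V} [DecidableRel G.Adj] {T T₀ : SimpleGraph V}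

lemma vol_mono {S B : Set V} (h : S ⊆ B) : vol G S ≤ vol G B := by
  classical
  exact sum_le_sum_of_subset_of_nonneg (monotone_filter_right _ fun _ _ hx => h hx)
    fun _ _ _ => Nat.cast_nonneg _

lemma vol_nonneg (S : Set V) : 0 ≤ vol G S := sum_nonneg fun _ _ => Nat.cast_nonneg _

lemma vol_univ : vol G Set.univ = 2 * (#G.edgeFinset : ℝ) := by
  simp [vol, sum_degree]

open scoped Classical in
lemma sum_degree_mul_treeCurrent (T : SimpleGraph V) (r a b : V) (S : Set V) :
    ∑ v with v ∈ S, (G.degree v : ℝ) * treeCurrent G T r v a b =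
      if IsParent T r b a then vol G (S ∩ subtree T r a) *
        (2 * (#G.edgeFinset : ℝ) - vol G (subtree T r a)) else 0 := by
  have hinter : vol G (S ∩ subtree T r a) =
      ∑ v with v ∈ S ∧ v ∈ subtree T r a, (G.degree v : ℝ) := by
    simp only [vol, Set.mem_inter_iff]
  simp only [treeCurrent_eq, onPath_def]
  split_ifs with h
  · simp only [h, true_and, mul_ite, mul_zero, ← sum_filter, filter_filter, hinter, sum_mul]
  · simp only [h, false_and, if_false, mul_zero, sum_const_zero]

/-- The parabola `x * (M - x)` lies below its tangent at `x = θ * M`. -/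
lemma vol_inter_mul_le {S B : Set V} {θ : ℝ} (hθ : θ ≤ 1 / 2) :
    vol G (S ∩ B) * (2 * (#G.edgeFinset : ℝ) - vol G B) ≤
      (1 - 2 * θ) * (2 * (#G.edgeFinset : ℝ)) * vol G S +
        θ ^ 2 * (2 * (#G.edgeFinset : ℝ)) ^ 2 := by
  set M := 2 * (#G.edgeFinset : ℝ)
  set x := vol G (S ∩ B)
  calc x * (M - vol G B) ≤ x * (M - x) := by
        gcongr
        · exact vol_nonneg _
        · exact vol_mono Set.inter_subset_right
    _ ≤ (1 - 2 * θ) * M * x + θ ^ 2 * M ^ 2 := by linarith [sq_nonneg (x - θ * M)]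
    _ ≤ (1 - 2 * θ) * M * vol G S + θ ^ 2 * M ^ 2 := by
        have hslope : 0 ≤ 1 - 2 * θ := by linarith
        gcongr
        exact vol_mono Set.inter_subset_left

open scoped Classical in
lemma sum_degree_mul_treeCurrent_mem (T : SimpleGraph V) (r a b : V) (S : Set V) {θ : ℝ}
    (hθ : θ ≤ 1 / 2) : ∑ v with v ∈ S, (G.degree v : ℝ) * treeCurrent G T r v a b ∈
      Set.Icc 0 ((1 - 2 * θ) * (2 * (#G.edgeFinset : ℝ)) * vol G S +
        θ ^ 2 * (2 * (#G.edgeFinset : ℝ)) ^ 2) := by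
  have hnonneg : 0 ≤ vol G (S ∩ subtree T r a) *
      (2 * (#G.edgeFinset : ℝ) - vol G (subtree T r a)) :=
    mul_nonneg (vol_nonneg _) (sub_nonneg.2 (vol_univ (G := G) ▸ vol_mono (Set.subset_univ _)))
  rw [sum_degree_mul_treeCurrent]
  split_ifs
  · exact ⟨hnonneg, vol_inter_mul_le hθ⟩
  · exact ⟨le_rfl, hnonneg.trans (vol_inter_mul_le hθ)⟩

open scoped Classical in
lemma sum_mul_sum_onPath (hT : T.IsTree) (r : V) (d : V → ℝ) (f : V → V → V → ℝ) :
    ∑ v, d v * (∑ a, ∑ b, if OnPath T r v a b then f v a b else 0) =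
      ∑ a with a ≠ r, ∑ v with v ∈ subtree T r a, d v * f v a (parent T r a) := by
  have hcollapse : ∀ v a, (∑ b, if OnPath T r v a b then f v a b else 0) =
      if a ≠ r then if v ∈ subtree T r a then f v a (parent T r a) else 0 else 0 := by
    intro v a
    simp only [onPath_def, ite_and]
    rw [sum_isParent hT (fun b => if v ∈ subtree T r a then f v a b else 0), ite_not]
  simp only [hcollapse, mul_sum]
  rw [sum_comm, sum_filter]
  refine sum_congr rfl fun a _ => ?_
  split_ifs <;> simp only [mul_ite, mul_zero, sum_filter, sum_const_zero]

open scoped Classical in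
lemma sum_vol_subtree (hT : T.IsTree) (r : V) :
    ∑ a with a ≠ r, vol G (subtree T r a) = ∑ v, (G.degree v : ℝ) * T.dist r v := by
  simp only [← sum_onPath_one hT]
  rw [sum_mul_sum_onPath hT]
  simp only [vol, mul_one]

lemma sum_degree_mul_dist_le (hG : G.Connected) {r : V} (hT : ∀ u, T.dist r u = G.dist r u) :
    ∑ v, (G.degree v : ℝ) * T.dist r v ≤ G.diam * (2 * (#G.edgeFinset : ℝ) - G.degree r) := by
  classical
  have : Nonempty V := hG.nonempty
  have hfinite : G.ediam ≠ ⊤ := G.connected_iff_ediam_ne_top.1 hG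
  rw [← sum_degree, ← add_sum_erase _ _ (mem_univ r),
    ← add_sum_erase _ (fun w => (G.degree w : ℝ)) (mem_univ r), add_sub_cancel_left, mul_sum,
    SimpleGraph.dist_self, Nat.cast_zero, mul_zero, zero_add]
  refine sum_le_sum fun v _ => ?_
  rw [mul_comm, hT]
  gcongr
  exact SimpleGraph.dist_le_diam hfinite

lemma abs_sampleValue_le_of_tangent (T : SimpleGraph V) (hG : G.Connected) (hT₀ : T₀.IsTree)
    {r : V} (hdist : ∀ u, T₀.dist r u = G.dist r u) {θ : ℝ} (hθ : θ ≤ 1 / 2) :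
    |sampleValue G T T₀ r| ≤ (1 - 2 * θ) * (2 * (#G.edgeFinset : ℝ)) *
      (G.diam * (2 * (#G.edgeFinset : ℝ) - G.degree r)) +
        (Fintype.card V - 1) * θ ^ 2 * (2 * (#G.edgeFinset : ℝ)) ^ 2 := by
  classical
  have hslope : 0 ≤ 1 - 2 * θ := by linarith
  have hcard : (#{a : V | a ≠ r} : ℝ) = Fintype.card V - 1 := by
    rw [filter_ne', card_erase_of_mem (mem_univ r), card_univ, Nat.cast_sub, Nat.cast_one]
    exact Fintype.card_pos_iff.2 ⟨r⟩
  set M := 2 * (#G.edgeFinset : ℝ)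
  rw [sampleValue, sum_mul_sum_onPath hT₀]
  calc _ ≤ ∑ a with a ≠ r, ((1 - 2 * θ) * M * vol G (subtree T₀ r a) + θ ^ 2 * M ^ 2) := by
        refine (abs_sum_le_sum_abs _ _).trans (sum_le_sum fun a _ => ?_)
        have hflow := fun b c => sum_degree_mul_treeCurrent_mem (G := G) T r b c
          (subtree T₀ r a) hθ
        simp only [mul_sub (G.degree _ : ℝ), sum_sub_distrib]
        exact abs_sub_le_of_nonneg_of_le (hflow _ _).1 (hflow _ _).2 (hflow _ _).1 (hflow _ _).2
    _ = (1 - 2 * θ) * M * ∑ v, (G.degree v : ℝ) * T₀.dist r v +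
          (Fintype.card V - 1) * θ ^ 2 * M ^ 2 := by
        rw [sum_add_distrib, ← mul_sum, sum_vol_subtree hT₀, sum_const, nsmul_eq_mul, hcard,
          mul_assoc _ (θ ^ 2)]
    _ ≤ (1 - 2 * θ) * M * (G.diam * (M - G.degree r)) +
          (Fintype.card V - 1) * θ ^ 2 * M ^ 2 := by
        gcongr
        exact sum_degree_mul_dist_le hG hdist

lemma degree_eq_of_diam_eq_one [Nontrivial V] (h : G.diam = 1) (v : V) :
    (G.degree v : ℝ) = Fintype.card V - 1 := by
  classical
  obtain rfl := SimpleGraph.diam_eq_one.1 h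
  have hdegree : (⊤ : SimpleGraph V).degree v = Fintype.card V - 1 := by
    convert SimpleGraph.complete_graph_degree v
  rw [hdegree, Nat.cast_sub Fintype.card_pos, Nat.cast_one]

/-- Up to the constraint `θ ≤ 1 / 2`, the minimizer is `θ = D / (N - 1)`. -/
lemma exists_tangent_bound {N D : ℝ} (hN : 2 ≤ N) (hD : 2 ≤ D) :
    ∃ θ ≤ 1 / 2, (1 - 2 * θ) * D + (N - 1) * θ ^ 2 ≤ D * ((N - 1) ^ 2 / N ^ 2) := by
  have hN1 : 0 < N - 1 := by linarith
  rcases le_or_gt (D / (N - 1)) (1 / 2) with h | h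
  · have hvalue : (1 - 2 * (D / (N - 1))) * D + (N - 1) * (D / (N - 1)) ^ 2 =
        D * ((N - 1 - D) / (N - 1)) := by
      field_simp
      ring
    refine ⟨D / (N - 1), h, hvalue.trans_le ?_⟩
    gcongr ?_ * ?_
    rw [div_le_div_iff₀ hN1 (by positivity)]
    nlinarith
  · rw [div_lt_div_iff₀ two_pos hN1] at h
    refine ⟨1 / 2, le_rfl, ?_⟩
    calc _ = (N - 1) * (1 / 4) := by ring
      _ ≤ (N - 1) * (D * (N - 1) / N ^ 2) := by
        gcongr ?_ * ?_
        rw [div_le_div_iff₀ four_pos (by positivity)]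
        nlinarith
      _ = D * ((N - 1) ^ 2 / N ^ 2) := by ring

lemma abs_sampleValue_le [Nontrivial V] (T : SimpleGraph V) (hG : G.Connected) (hT₀ : T₀.IsTree)
    {r : V} (hdist : ∀ u, T₀.dist r u = G.dist r u) :
    |sampleValue G T T₀ r| ≤ (2 * (#G.edgeFinset : ℝ)) ^ 2 * G.diam *
      (((Fintype.card V : ℝ) - 1) ^ 2 / (Fintype.card V : ℝ) ^ 2) := by
  have hbound := fun θ (hθ : θ ≤ 1 / 2) =>
    abs_sampleValue_le_of_tangent (G := G) T hG hT₀ hdist hθ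
  have hN : (2 : ℝ) ≤ Fintype.card V := by exact_mod_cast Fintype.one_lt_card (α := V)
  rcases (Nat.succ_le_of_lt (diam_pos hG)).eq_or_lt' with hdiam | hdiam
  · have hedges : 2 * (#G.edgeFinset : ℝ) = Fintype.card V * (Fintype.card V - 1) := by
      simp only [← sum_degree, degree_eq_of_diam_eq_one hdiam, sum_const, card_univ, nsmul_eq_mul]
    refine (hbound (1 / Fintype.card V) (one_div_le_one_div_of_le two_pos hN)).trans_eq ?_
    rw [hedges, degree_eq_of_diam_eq_one hdiam, hdiam, Nat.cast_one]
    field_simp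
    ring
  · have hD : (2 : ℝ) ≤ G.diam := by exact_mod_cast hdiam
    obtain ⟨θ, hθ, hle⟩ := exists_tangent_bound hN hD
    have hslope : 0 ≤ 1 - 2 * θ := by linarith
    set M := 2 * (#G.edgeFinset : ℝ)
    calc |sampleValue G T T₀ r|
        ≤ (1 - 2 * θ) * M * (G.diam * (M - G.degree r)) +
          (Fintype.card V - 1) * θ ^ 2 * M ^ 2 := hbound θ hθ
      _ ≤ (1 - 2 * θ) * M * (G.diam * M) + (Fintype.card V - 1) * θ ^ 2 * M ^ 2 := by
          gcongr
          exact sub_le_self _ (Nat.cast_nonneg _)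
      _ = M ^ 2 * ((1 - 2 * θ) * G.diam + (Fintype.card V - 1) * θ ^ 2) := by ring
      _ ≤ M ^ 2 * (G.diam * (((Fintype.card V : ℝ) - 1) ^ 2 / (Fintype.card V : ℝ) ^ 2)) := by
          gcongr
      _ = _ := (mul_assoc _ _ _).symm

variable [DecidableEq V]

lemma abs_sampleValue_div_le [Nontrivial V] (hG : G.Connected) (hT₀ : T₀.IsTree) (i : V) {r : V}
    (hdist : ∀ u, T₀.dist r u = G.dist r u) (T : SimpleGraph V) :
    |sampleValue G T T₀ r / (2 * (#G.edgeFinset : ℝ))| ≤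
      2 * (#G.edgeFinset : ℝ) * G.diam * kemeny G i / Fintype.card V := by
  have hM := two_mul_card_edgeFinset_pos hG
  have hκ := le_kemeny hG i
  have hvalue := abs_sampleValue_le T hG hT₀ hdist
  set M := 2 * (#G.edgeFinset : ℝ)
  rw [abs_div, abs_of_pos hM, div_le_iff₀ hM]
  calc |sampleValue G T T₀ r|
      ≤ M ^ 2 * G.diam * (((Fintype.card V : ℝ) - 1) ^ 2 / (Fintype.card V : ℝ) ^ 2) := hvalue
    _ = M ^ 2 * G.diam * (((Fintype.card V : ℝ) - 1) ^ 2 / Fintype.card V) / Fintype.card V := by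
        ring
    _ ≤ M ^ 2 * G.diam * kemeny G i / Fintype.card V := by gcongr
    _ = M * G.diam * kemeny G i / Fintype.card V * M := by ring

end Range

section Concentration

lemma integral_uniformOn_univ {α : Type*} [MeasurableSpace α] [MeasurableSingletonClass α]
    [Fintype α] [Nonempty α] (f : α → ℝ) :
    ∫ x, f x ∂(uniformOn (Set.univ : Set α)) = (∑ x, f x) / Fintype.card α := by
  have := isProbabilityMeasure_uniformOn (Set.finite_univ (α := α)) Set.univ_nonempty
  rw [integral_fintype Integrable.of_finite, sum_div]
  refine sum_congr rfl fun x _ => ?_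
  rw [Measure.real, uniformOn_univ]
  simp [div_eq_inv_mul]

variable {Ω ι : Type*} [MeasurableSpace Ω] {μ : Measure Ω} [IsProbabilityMeasure μ] [Fintype ι]
  {X : ι → Ω → ℝ} {B t : ℝ}

lemma measureReal_le_sum_sub_integral_le (hm : ∀ k, AEMeasurable (X k) μ) (hX : iIndepFun X μ)
    (hB : ∀ k x, |X k x| ≤ B) (ht : 0 ≤ t) :
    μ.real {x | t ≤ ∑ k, (X k x - ∫ y, X k y ∂μ)} ≤
      Real.exp (-t ^ 2 / (2 * (Fintype.card ι * B ^ 2))) := by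
  have hsubG : ∀ k ∈ (univ : Finset ι),
      HasSubgaussianMGF (fun x => X k x - ∫ y, X k y ∂μ) ((‖B - -B‖₊ / 2) ^ 2) μ :=
    fun k _ => hasSubgaussianMGF_of_mem_Icc (hm k) (ae_of_all _ fun x => abs_le.1 (hB k x))
  have hindep : iIndepFun (fun k x => X k x - ∫ y, X k y ∂μ) μ :=
    hX.comp (fun k y => y - ∫ z, X k z ∂μ) fun _ => measurable_id.sub_const _
  have hvariance : ((∑ _k : ι, (‖B - -B‖₊ / 2) ^ 2 : NNReal) : ℝ) = Fintype.card ι * B ^ 2 := by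
    simp [← two_mul, sq_abs]
  rw [← hvariance]
  exact HasSubgaussianMGF.measure_sum_ge_le_of_iIndepFun hindep hsubG ht

lemma measureReal_le_abs_sum_sub_integral_le (hm : ∀ k, AEMeasurable (X k) μ) (hX : iIndepFun X μ)
    (hB : ∀ k x, |X k x| ≤ B) (ht : 0 ≤ t) :
    μ.real {x | t ≤ |∑ k, (X k x - ∫ y, X k y ∂μ)|} ≤
      2 * Real.exp (-t ^ 2 / (2 * (Fintype.card ι * B ^ 2))) := by
  have hupper := measureReal_le_sum_sub_integral_le hm hX hB ht
  have hlower := measureReal_le_sum_sub_integral_le (X := fun k => -X k) (fun k => (hm k).neg)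
    (hX.comp (fun _ y => -y) fun _ => measurable_neg) (fun k x => (abs_neg _).trans_le (hB k x)) ht
  have hneg : ∀ x, ∑ k, ((-X k) x - ∫ y, (-X k) y ∂μ) = -∑ k, (X k x - ∫ y, X k y ∂μ) := by
    intro x
    simp only [Pi.neg_apply, integral_neg, ← neg_sub', sum_neg_distrib]
  simp only [hneg] at hlower
  simp only [le_abs]
  rw [two_mul]
  exact (measureReal_union_le _ _).trans (add_le_add hupper hlower)

lemma two_mul_exp_neg_le {N : ℝ} (hN : 0 < N) (hB : 0 < B) (ht : 0 < t) {p : ℝ} (hp : 0 < p)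
    (h : 2 * B ^ 2 * Real.log (2 / p) / t ^ 2 ≤ N) :
    2 * Real.exp (-(N * t) ^ 2 / (2 * (N * B ^ 2))) ≤ p := by
  rw [div_le_iff₀ (pow_pos ht 2)] at h
  rw [← le_div_iff₀' two_pos, ← Real.le_log_iff_exp_le (half_pos hp), ← inv_div 2 p, Real.log_inv,
    neg_div, neg_le_neg_iff, le_div_iff₀ (by positivity)]
  linarith [mul_le_mul_of_nonneg_left h hN.le]

/-- Hoeffding's inequality, solved for the sample size. -/
lemma one_sub_le_measureReal_abs_mean_sub_le (hm : ∀ k, AEMeasurable (X k) μ)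
    (hX : iIndepFun X μ) (hB : ∀ k x, |X k x| ≤ B) (hB₀ : 0 < B) {c : ℝ}
    (hc : ∀ k, ∫ x, X k x ∂μ = c) (ht : 0 < t) {p : ℝ} (hp : 0 < p)
    (hι : 2 * B ^ 2 * Real.log (2 / p) / t ^ 2 ≤ Fintype.card ι) :
    1 - p ≤ μ.real {x | |(∑ k, X k x) / Fintype.card ι - c| ≤ t} := by
  rcases isEmpty_or_nonempty ι with hempty | hnonempty
  · rw [Fintype.card_eq_zero, Nat.cast_zero, div_le_iff₀ (pow_pos ht 2), zero_mul] at hι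
    have hlog : Real.log (2 / p) ≤ 0 := nonpos_of_mul_nonpos_right hι (by positivity)
    rw [Real.log_nonpos_iff (by positivity), div_le_one hp] at hlog
    exact (by linarith : 1 - p ≤ 0).trans measureReal_nonneg
  have hN : (0 : ℝ) < Fintype.card ι := Nat.cast_pos.2 Fintype.card_pos
  set N := (Fintype.card ι : ℝ)
  have htail := (measureReal_le_abs_sum_sub_integral_le hm hX hB (mul_pos hN ht).le).trans
    (two_mul_exp_neg_le hN hB₀ ht hp hι)
  have hcover : Set.univ ⊆ {x | |(∑ k, X k x) / N - c| ≤ t} ∪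
      {x | N * t ≤ |∑ k, (X k x - ∫ y, X k y ∂μ)|} := by
    intro x _
    have hsum : ∑ k, (X k x - ∫ y, X k y ∂μ) = N * ((∑ k, X k x) / N - c) := by
      simp only [hc, sum_sub_distrib, sum_const, card_univ, nsmul_eq_mul]
      rw [mul_sub, mul_div_cancel₀ _ hN.ne']
    refine (le_total |(∑ k, X k x) / N - c| t).imp id fun h => ?_
    rw [Set.mem_ofPred_eq, hsum, abs_mul, abs_of_pos hN]
    gcongr
  have hunion := (measureReal_mono (μ := μ) hcover).trans (measureReal_union_le _ _)
  rw [probReal_univ] at hunion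
  linarith

end Concentration

section Sampling

variable {V : Type*} [Fintype V] {G : SimpleGraph V} {Ω : Type*} [MeasurableSpace Ω] {μ : Measure Ω}
  {σ : Ω → SpanningTree G}

lemma integral_uniform_spanningTree [Nonempty (SpanningTree G)]
    (hσ : HasLaw σ (uniformOn Set.univ) μ) (f : SimpleGraph V → ℝ) :
    ∫ x, f (σ x).1 ∂μ = (∑ T ∈ trees G, f T) / #(trees G) := by
  classical
  have : MeasurableSingletonClass (SpanningTree G) := ⟨fun _ => trivial⟩
  let _ : Fintype (SpanningTree G) := Subtype.fintype fun T : SimpleGraph V => T ≤ G ∧ T.IsTree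
  refine (hσ.integral_comp (f := fun T : SpanningTree G => f T.1)
    measurable_from_top.aestronglyMeasurable).trans ?_
  rw [integral_uniformOn_univ, sum_subtype (trees G) (fun _ => mem_trees) f]
  congr 2
  exact Fintype.card_of_subtype (trees G) fun _ => mem_trees

variable [Nontrivial V] [DecidableRel G.Adj] [DecidableEq V]

lemma integral_sampleValue (hG : G.Connected) (i r : V) (T₀ : SpanningTree G)
    (hσ : HasLaw σ (uniformOn Set.univ) μ) :
    ∫ x, sampleValue G (σ x).1 T₀.1 r / (2 * (#G.edgeFinset : ℝ)) ∂μ = kemeny G i := by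
  have : Nonempty (SpanningTree G) := ⟨T₀⟩
  have hcard : (#(trees G) : ℝ) ≠ 0 := Nat.cast_ne_zero.2 (card_trees_pos hG).ne'
  rw [integral_div, integral_uniform_spanningTree hσ fun T => sampleValue G T T₀.1 r,
    sum_sampleValue hG T₀.2.1 T₀.2.2, mul_div_cancel_left₀ _ hcard, kemeny_const hG i r,
    kemeny_eq hG]

end Sampling

end TTF

theorem mainTheorem4 {V : Type*} [Fintype V] [DecidableEq V] [Nontrivial V]
    (G : SimpleGraph V) [DecidableRel G.Adj] (hG : G.Connected)
    (i r : V) (T₀ : TTF.SpanningTree G) (hT₀ : TTF.IsBFSTree G r T₀)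
    {Ω : Type*} [MeasurableSpace Ω] (μ : Measure Ω) [IsProbabilityMeasure μ]
    (ω : ℕ) (τ : Fin ω → Ω → TTF.SpanningTree G)
    (hunif : ∀ k, HasLaw (τ k) (uniformOn Set.univ) μ) (hindep : iIndepFun τ μ)
    (ε p_f : ℝ) (hε : 0 < ε) (hp : 0 < p_f)
    (hω : 8 * (G.edgeFinset.card : ℝ) ^ 2 * (G.diam : ℝ) ^ 2 * Real.log (2 / p_f)
        / ((Fintype.card V : ℝ) ^ 2 * ε ^ 2) ≤ (ω : ℝ)) :
    1 - p_f ≤ μ.real {x | |TTF.ttf G r T₀ (fun k => τ k x) - TTF.kemeny G i|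
        ≤ ε * TTF.kemeny G i} := by
  have hM := TTF.two_mul_card_edgeFinset_pos hG
  have hκ := TTF.kemeny_pos hG i
  have hΔ : (0 : ℝ) < G.diam := Nat.cast_pos.2 (TTF.diam_pos hG)
  have : (0 : ℝ) < Fintype.card V := Nat.cast_pos.2 Fintype.card_pos
  let estimate : TTF.SpanningTree G → ℝ := fun T =>
    TTF.sampleValue G T.1 T₀.1 r / (2 * (G.edgeFinset.card : ℝ))
  have hestimate : Measurable estimate := measurable_from_top
  have hsize : 2 * (2 * (G.edgeFinset.card : ℝ) * G.diam * TTF.kemeny G i / Fintype.card V) ^ 2 *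
      Real.log (2 / p_f) / (ε * TTF.kemeny G i) ^ 2 ≤ Fintype.card (Fin ω) := by
    rw [Fintype.card_fin]
    refine Eq.trans_le ?_ hω
    field_simp
    ring
  have hmean := TTF.one_sub_le_measureReal_abs_mean_sub_le (X := fun k x => estimate (τ k x))
    (fun k => hestimate.comp_aemeasurable (hunif k).aemeasurable)
    (hindep.comp (fun _ => estimate) fun _ => hestimate)
    (fun k x => TTF.abs_sampleValue_div_le hG T₀.2.2 i hT₀ (τ k x).1) (by positivity)
    (fun k => TTF.integral_sampleValue hG i r T₀ (hunif k)) (mul_pos hε hκ) hp hsize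
  simpa only [TTF.ttf_eq, Fintype.card_fin] using hmean
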